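/- Let $X\in\mathbb R^{n\times d}$ have full column rank and let $y=X\beta+\varepsilon$ with $\varepsilon_1,\dots,\varepsilon_n$ i.i.d. $\mathcal N(0,\sigma^2)$, $\sigma^2>0$. Put $\Sigma=(X^{\mathsf T}X)^{-1}$, $\widehat\beta=\Sigma X^{\mathsf T}y$ and $\widehat\sigma^2=\|y-X\widehat\beta\|^2/(n-d)$ (read $(n-d)\widehat\sigma^2=0$ if $n=d$). Let $\Delta\in\mathbb R^{d\times d}$ be a matrix (for instance a diagonal one) such that $\Delta-\Sigma$ is symmetric positive semidefinite, let $r=\operatorname{rank}(\Delta-\Sigma)$, and suppose $n\ge d+r$. Let $v\sim\mathrm{Beta}\left(\frac r2,\frac{n-d-r}2\right)$ and $\omega'\sim\mathcal N_r(0,I_r)$, where $y$, $v$ and $\omega'$ are mutually independent; here $v=1$ almost surely if $n=d+r$, and $v=0$ almost surely if $r=0$ and $n>d$. Then $$(n-d)\,v\,\widehat\sigma^2\sim\sigma^2\chi^2_r .$$ Moreover, there is a matrix $M\in\mathbb R^{d\times r}$ with $MM^{\mathsf T}=\Delta-\Sigma$, and for every such $M$ the vector $$\omega=\sqrt{\frac{(n-d)\,v\,\widehat\sigma^2}{\|\omega'\|^2}}\;M\omega'$$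 (read as $0$ if $\omega'=0$) has law $\omega\sim\mathcal N_d\left(0,\sigma^2(\Delta-\Sigma)\right)$ and is independent of $\widehat\beta$. Thus the whitening noise can be carved from $\widehat\sigma^2$ whenever $n\ge d+r$. -/

import Mathlib

open MeasureTheory ProbabilityTheory Matrix

noncomputable section

/-- `Σ = (XᵀX)⁻¹`; the least squares estimator has covariance `σ² Σ`. -/
def designCov {n d : ℕ} (X : Matrix (Fin n) (Fin d) ℝ) : Matrix (Fin d) (Fin d) ℝ :=
  (Xᵀ * X)⁻¹

/-- The ordinary least squares estimator `(XᵀX)⁻¹ Xᵀ y`. -/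
def olsEstimator {n d : ℕ} (X : Matrix (Fin n) (Fin d) ℝ) (y : EuclideanSpace ℝ (Fin n)) :
    EuclideanSpace ℝ (Fin d) :=
  WithLp.toLp 2 (((Xᵀ * X)⁻¹ * Xᵀ) *ᵥ y.ofLp)

/-- The residual variance `‖y - X β̂‖² / (n - d)` (Euclidean norm, `β̂` the least squares
estimator). -/
def residualVariance {n d : ℕ} (X : Matrix (Fin n) (Fin d) ℝ) (y : EuclideanSpace ℝ (Fin n)) : ℝ :=
  ‖y - WithLp.toLp 2 (X *ᵥ (olsEstimator X y).ofLp)‖ ^ 2 / ((n : ℝ) - d)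

/-- The chi-square distribution with `k` degrees of freedom: the law of the squared Euclidean
norm of a standard Gaussian vector in `ℝᵏ` (the point mass at `0` for `k = 0`). -/
def chiSquared (k : ℕ) : Measure ℝ :=
  (stdGaussian (EuclideanSpace ℝ (Fin k))).map (fun x => ‖x‖ ^ 2)

/-- The Beta distribution with parameters `a, b ≥ 0`, with its degenerate limits: the point mass
at `1` when `b = 0`, and the point mass at `0` when `a = 0 < b`. -/
def extendedBeta (a b : ℝ) : Measure ℝ :=
  if b = 0 then Measure.dirac 1 else if a = 0 then Measure.dirac 0 else betaMeasure a b

/-- The noise `√((n - d) v σ̂² / ‖w‖²) • M w`, computed from the data `y` (through `σ̂²` only) and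
auxiliary `v : ℝ` and `w : ℝʳ`. -/
def carvedNoise {n d r : ℕ} (X : Matrix (Fin n) (Fin d) ℝ) (M : Matrix (Fin d) (Fin r) ℝ)
    (y : EuclideanSpace ℝ (Fin n)) (v : ℝ) (w : EuclideanSpace ℝ (Fin r)) :
    EuclideanSpace ℝ (Fin d) :=
  Real.sqrt (((n : ℝ) - d) * v * residualVariance X y / ‖w‖ ^ 2) • WithLp.toLp 2 (M *ᵥ w.ofLp)

end

/-! Write `y = Xβ + σg` with `g` standard Gaussian. Its components in the column space of `X` and in
the orthogonal complement are independent (`map_add_stdGaussian_prod_stdGaussian_orthogonal`). The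
estimator `β̂` sees only the first, and `S = (n - d) σ̂²` is `σ²` times the squared length of the
second, which lives in dimension `n - d`. So `S` is `σ² χ²_{n-d}` and independent of `β̂`
(`exists_map_olsEstimator_residualVariance`).

A `Beta(a, b)` fraction of an independent `Gamma(a + b)` variable is `Gamma(a)`. With `a = r/2` and
`b = (n - d - r)/2`, the product `v S` is `σ² χ²_r` (`map_mul_extendedBeta_prod_chiSquared`).

A Gaussian vector has independent direction and length. Pairing the direction of `ω'` with the
squared length `v S` therefore rebuilds a `N(0, σ² I_r)` vector (`hasLaw_sqrt_smul_direction`), and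
`M` turns its covariance into `σ² M Mᵀ`. The noise is a function of `(S, v, ω')`, and this triple is
jointly independent of `β̂`. -/

/-! ### Gaussian density and polar coordinates -/

section Polar

variable {E : Type*} [NormedAddCommGroup E] [InnerProductSpace ℝ E] [FiniteDimensional ℝ E]
  [MeasurableSpace E] [BorelSpace E]

variable (E) in
/-- The standard Gaussian measure has a density proportional to `exp (-‖x‖² / 2)`. -/
theorem stdGaussian_eq_withDensity : stdGaussian E = volume.withDensity fun x : E =>
    ENNReal.ofReal (((2 * Real.pi) ^ (Module.finrank ℝ E / 2 : ℝ))⁻¹ * Real.exp (-‖x‖ ^ 2 / 2)) := by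
  set c : ℝ := (2 * Real.pi) ^ (Module.finrank ℝ E / 2 : ℝ) with hc
  have hc0 : 0 < c := by positivity
  have hint : Integrable fun x : E => c⁻¹ * Real.exp (-‖x‖ ^ 2 / 2) := by
    have h := (GaussianFourier.integrable_cexp_neg_mul_sq_norm_add (b := (1 / 2 : ℂ)) (V := E)
      (by norm_num) 0 0).re
    refine (h.congr (.of_forall fun x => ?_)).const_mul _
    have : (-(1 / 2 : ℂ) * (‖x‖ : ℂ) ^ 2 + 0 * ((inner ℝ (0 : E) x : ℝ) : ℂ))
        = ((-‖x‖ ^ 2 / 2 : ℝ) : ℂ) := by push_cast; ring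
    simp only [this, ← Complex.ofReal_exp]
    exact Complex.ofReal_re _
  have : IsFiniteMeasure (volume.withDensity fun x : E =>
      ENNReal.ofReal (c⁻¹ * Real.exp (-‖x‖ ^ 2 / 2))) :=
    isFiniteMeasure_withDensity_ofReal hint.2
  refine Measure.ext_of_charFun (funext fun t => ?_)
  rw [charFun_stdGaussian, charFun_apply,
    integral_withDensity_eq_integral_toReal_smul (by fun_prop) (by simp)]
  -- For `b = 1/2` the prefactor `(π / b) ^ (dim / 2)` is `c`, and the linear coefficient `i` gives
  -- the exponent `i² ‖t‖² / (4b) = -‖t‖² / 2`.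
  have h := GaussianFourier.integral_cexp_neg_mul_sq_norm_add (b := (1 / 2 : ℂ)) (V := E)
      (by norm_num) Complex.I t
  have hcc : ((Real.pi : ℂ) / (1 / 2)) ^ (Module.finrank ℝ E / 2 : ℂ) = (c : ℂ) := by
    rw [hc, Complex.ofReal_cpow (by positivity)]
    push_cast
    congr 1
    ring
  rw [hcc] at h
  have h2 : ∀ x : E, (ENNReal.ofReal (c⁻¹ * Real.exp (-‖x‖ ^ 2 / 2))).toReal •
      Complex.exp ((inner ℝ x t : ℝ) * Complex.I) = (c : ℂ)⁻¹ *
        Complex.exp (-(1 / 2) * ‖x‖ ^ 2 + Complex.I * (inner ℝ t x : ℝ)) := by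
    intro x
    rw [ENNReal.toReal_ofReal (by positivity), Complex.real_smul, Complex.exp_add]
    push_cast
    rw [real_inner_comm, mul_assoc]
    congr 3
    · ring_nf
    · ring_nf
  simp_rw [h2]
  rw [integral_const_mul, h, ← mul_assoc, inv_mul_cancel₀ (by exact_mod_cast hc0.ne'), one_mul]
  congr 1
  rw [Complex.I_sq]
  ring

/-- Integration in polar coordinates. -/
theorem lintegral_polar [Nontrivial E] (μ : Measure E) [μ.IsAddHaarMeasure] {F : E × ℝ → ENNReal}
    (hF : Measurable F) :
    ∫⁻ x, F (‖x‖⁻¹ • x, ‖x‖) ∂μ = ∫⁻ u, (∫⁻ r in Set.Ioi (0 : ℝ),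
      ENNReal.ofReal (r ^ (Module.finrank ℝ E - 1)) * F (u, r)) ∂μ.toSphere.map Subtype.val := by
  have h := μ.measurePreserving_homeomorphUnitSphereProd.lintegral_comp_emb
    (Homeomorph.measurableEmbedding _) (fun p => F ((p.1 : E), (p.2 : ℝ)))
  have hF2 : Measurable fun p : Metric.sphere (0 : E) 1 × Set.Ioi (0 : ℝ) =>
      F ((p.1 : E), (p.2 : ℝ)) := by fun_prop
  calc ∫⁻ x, F (‖x‖⁻¹ • x, ‖x‖) ∂μ
      = ∫⁻ x in {0}ᶜ, F (‖x‖⁻¹ • x, ‖x‖) ∂μ := by rw [restrict_compl_singleton]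
    _ = ∫⁻ x : ({0}ᶜ : Set E), F (‖(x : E)‖⁻¹ • (x : E), ‖(x : E)‖) ∂μ.comap (↑) :=
      (lintegral_subtype_comap (measurableSet_singleton _).compl _).symm
    _ = ∫⁻ p, F ((p.1 : E), (p.2 : ℝ)) ∂μ.toSphere.prod (Measure.volumeIoiPow (Module.finrank ℝ E - 1)) := by
      rw [← h]; simp
    _ = _ := by
      rw [lintegral_prod _ hF2.aemeasurable, lintegral_map ?_ measurable_subtype_coe]
      · refine lintegral_congr fun u => ?_
        rw [Measure.volumeIoiPow, lintegral_withDensity_eq_lintegral_mul _ (by fun_prop)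
          (by fun_prop)]
        exact lintegral_subtype_comap measurableSet_Ioi
          (fun r : ℝ => ENNReal.ofReal (r ^ (Module.finrank ℝ E - 1)) * F (u, r))
      · exact Measurable.lintegral_prod_right (by fun_prop)

end Polar

/-- If the joint law of two random variables is a product of measures then they are independent. -/
theorem indepFun_of_map_prodMk_eq_prod {Ω α β : Type*} [MeasurableSpace Ω] [MeasurableSpace α]
    [MeasurableSpace β] {P : Measure Ω} [IsProbabilityMeasure P] {X : Ω → α} {Y : Ω → β}
    (hX : AEMeasurable X P) (hY : AEMeasurable Y P) {μ : Measure α} {ν : Measure β}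
    [SFinite μ] [SFinite ν] (h : P.map (fun s => (X s, Y s)) = μ.prod ν) :
    IndepFun X Y P := by
  have hX' : P.map X = ν Set.univ • μ := by
    rw [← Measure.map_fst_prod, ← h, AEMeasurable.map_map_of_aemeasurable (by fun_prop)
      (hX.prodMk hY)]
    rfl
  have hY' : P.map Y = μ Set.univ • ν := by
    rw [← Measure.map_snd_prod, ← h, AEMeasurable.map_map_of_aemeasurable (by fun_prop)
      (hX.prodMk hY)]
    rfl
  -- `μ` and `ν` need not be normalised: each marginal carries the total mass of the other factor,
  -- and only the product of the masses is 1.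
  have h1 : ν Set.univ * μ Set.univ = 1 := by
    have := congrArg (· Set.univ) hX'
    simpa [hX] using this.symm
  rw [indepFun_iff_map_prod_eq_prod_map_map hX hY, h, hX', hY', Measure.prod_smul_left,
    Measure.prod_smul_right, smul_smul, h1, one_smul]

/-- The change of variables `s = r²` in an integral against a Gamma distribution. -/
theorem exists_lintegral_sq_eq_lintegral_gammaMeasure {k : ℕ} (hk : 0 < k) (c : ℝ) (hc : 0 < c) :
    ∃ C : ENNReal, C ≠ ⊤ ∧ ∀ f : ℝ → ENNReal, Measurable f →
      ∫⁻ r in Set.Ioi (0 : ℝ), ENNReal.ofReal (r ^ (k - 1)) *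
        (ENNReal.ofReal (c * Real.exp (-r ^ 2 / 2)) * f (r ^ 2)) =
      C * ∫⁻ s, f s ∂gammaMeasure (k / 2) (1 / 2) := by
  set D : ℝ := (1 / 2 : ℝ) ^ (k / 2 : ℝ) / Real.Gamma (k / 2) with hD
  have hk' : (0 : ℝ) < k / 2 := by positivity
  have hD0 : 0 < D := div_pos (by positivity) (Real.Gamma_pos_of_pos hk')
  -- `D` normalises the Gamma density, and the 2 comes from `ds = 2r dr`.
  refine ⟨ENNReal.ofReal (c / (2 * D)), ENNReal.ofReal_ne_top, fun f hf => ?_⟩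
  have himg : (fun r : ℝ => r ^ 2) '' Set.Ioi 0 = Set.Ioi 0 := by
    ext s
    constructor
    · rintro ⟨r, hr, rfl⟩
      exact pow_pos (Set.mem_Ioi.1 hr) 2
    · intro hs
      exact ⟨√s, Real.sqrt_pos.2 hs, Real.sq_sqrt (le_of_lt hs)⟩
  have hgm : Measurable (gammaPDF (k / 2) (1 / 2)) :=
    (measurable_gammaPDFReal _ _).ennreal_ofReal
  have hsupp : ∫⁻ s, f s ∂gammaMeasure (k / 2) (1 / 2) =
      ∫⁻ s in Set.Ioi 0, gammaPDF (k / 2) (1 / 2) s * f s := by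
    rw [gammaMeasure, lintegral_withDensity_eq_lintegral_mul _ hgm hf,
      setLIntegral_congr Ioi_ae_eq_Ici, ← lintegral_indicator measurableSet_Ici]
    refine lintegral_congr fun s => ?_
    by_cases hs : 0 ≤ s
    · simp [Set.indicator, hs]
    · simp [Set.indicator, hs, gammaPDF_of_neg (not_le.1 hs)]
  rw [hsupp]
  conv_rhs => rw [← himg]
  rw [lintegral_image_eq_lintegral_abs_deriv_mul measurableSet_Ioi
    (f' := fun r => 2 * r) (fun r _ => by
      simpa using (hasDerivAt_pow 2 r).hasDerivWithinAt)
    (fun a ha b hb hab => (pow_left_inj₀ (le_of_lt ha) (le_of_lt hb) two_ne_zero).1 hab),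
    ← lintegral_const_mul _ (by fun_prop)]
  refine setLIntegral_congr_fun measurableSet_Ioi fun r (hr : 0 < r) => ?_
  rw [gammaPDF_of_nonneg (by positivity), ← mul_assoc, ← mul_assoc, ← mul_assoc,
    ← ENNReal.ofReal_mul (by positivity), ← ENNReal.ofReal_mul (by positivity),
    ← ENNReal.ofReal_mul (by positivity)]
  congr 2
  rw [← hD, abs_of_pos (by positivity), ← Real.rpow_natCast (r) 2, ← Real.rpow_mul hr.le]
  have h1 : r ^ (k - 1) = r * r ^ (((2 : ℕ) : ℝ) * ((k : ℝ) / 2 - 1)) := by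
    rw [← Real.rpow_natCast, Nat.cast_sub hk]
    nth_rw 2 [← Real.rpow_one r]
    rw [← Real.rpow_add hr]
    congr 1
    push_cast
    ring
  rw [h1, Real.rpow_natCast r 2, show -(1 / 2 * r ^ 2) = -r ^ 2 / 2 by ring]
  field_simp

/-! ### Direction and length of a Gaussian vector -/

section Polar

variable {E : Type*} [NormedAddCommGroup E] [InnerProductSpace ℝ E] [FiniteDimensional ℝ E]
  [MeasurableSpace E] [BorelSpace E]

/-- The density is radial, so in polar coordinates it splits into a sphere factor and a radial
factor. The constant `C` need not be computed: comparing total masses fixes it whenever it matters.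
-/
theorem exists_map_direction_sq_norm_stdGaussian [Nontrivial E] :
    ∃ C : ENNReal, C ≠ ⊤ ∧ (stdGaussian E).map (fun x => (‖x‖⁻¹ • x, ‖x‖ ^ 2)) =
      ((volume : Measure E).toSphere.map Subtype.val).prod
        (C • gammaMeasure (Module.finrank ℝ E / 2) (1 / 2)) := by
  obtain ⟨C, hC, h⟩ := exists_lintegral_sq_eq_lintegral_gammaMeasure
    (Module.finrank_pos (R := ℝ) (M := E)) ((2 * Real.pi) ^ (Module.finrank ℝ E / 2 : ℝ))⁻¹
    (by positivity)
  have : IsProbabilityMeasure (gammaMeasure (Module.finrank ℝ E / 2) (1 / 2)) :=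
    isProbabilityMeasure_gammaMeasure
      (by have := Module.finrank_pos (R := ℝ) (M := E); positivity) (by norm_num)
  have : IsFiniteMeasure (C • gammaMeasure (Module.finrank ℝ E / 2) (1 / 2)) :=
    Measure.smul_finite _ hC
  refine ⟨C, hC, Measure.ext_of_lintegral _ fun f hf => ?_⟩
  rw [lintegral_map hf (by fun_prop), lintegral_prod _ hf.aemeasurable, stdGaussian_eq_withDensity,
    lintegral_withDensity_eq_lintegral_mul _ (by fun_prop) (by fun_prop)]
  have := lintegral_polar (E := E) volume (F := fun p => ENNReal.ofReal
    (((2 * Real.pi) ^ (Module.finrank ℝ E / 2 : ℝ))⁻¹ * Real.exp (-p.2 ^ 2 / 2)) *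
      f (p.1, p.2 ^ 2)) (by fun_prop)
  simp only [Pi.mul_apply]
  rw [this]
  refine lintegral_congr fun u => ?_
  rw [lintegral_smul_measure]
  exact h (fun s => f (u, s)) (by fun_prop)

/-- The direction and the length of a standard Gaussian vector are independent. -/
theorem indepFun_direction_sq_norm_stdGaussian :
    IndepFun (fun x : E => ‖x‖⁻¹ • x) (fun x => ‖x‖ ^ 2) (stdGaussian E) := by
  rcases subsingleton_or_nontrivial E with hE | hE
  · have : (fun x : E => ‖x‖⁻¹ • x) = fun _ => 0 := funext fun x => Subsingleton.elim _ _
    rw [this]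
    exact indepFun_const_left _ _
  · obtain ⟨C, hC, h⟩ := exists_map_direction_sq_norm_stdGaussian (E := E)
    have : IsProbabilityMeasure (gammaMeasure (Module.finrank ℝ E / 2) (1 / 2)) :=
      isProbabilityMeasure_gammaMeasure
        (by have := Module.finrank_pos (R := ℝ) (M := E); positivity) (by norm_num)
    exact indepFun_of_map_prodMk_eq_prod (by fun_prop) (by fun_prop) h

theorem map_sq_norm_stdGaussian [Nontrivial E] :
    (stdGaussian E).map (fun x => ‖x‖ ^ 2) = gammaMeasure (Module.finrank ℝ E / 2) (1 / 2) := by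
  obtain ⟨C, hC, h⟩ := exists_map_direction_sq_norm_stdGaussian (E := E)
  have hγ : IsProbabilityMeasure (gammaMeasure (Module.finrank ℝ E / 2) (1 / 2)) :=
    isProbabilityMeasure_gammaMeasure
      (by have := Module.finrank_pos (R := ℝ) (M := E); positivity) (by norm_num)
  have h2 := congrArg (Measure.map Prod.snd) h
  rw [Measure.map_map (by fun_prop) (by fun_prop), Measure.map_snd_prod, smul_smul] at h2
  change (stdGaussian E).map (fun x => ‖x‖ ^ 2) = _ at h2
  have : IsProbabilityMeasure ((stdGaussian E).map (fun x => ‖x‖ ^ 2)) :=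
    Measure.isProbabilityMeasure_map (by fun_prop)
  have h3 := congrArg (· Set.univ) h2
  simp only [measure_univ, Measure.smul_apply, smul_eq_mul, mul_one] at h3
  rw [h2, ← h3, one_smul]

end Polar

/-! ### Beta fractions of Gamma variables -/

theorem chiSquared_eq_gammaMeasure {k : ℕ} (hk : 0 < k) :
    chiSquared k = gammaMeasure (k / 2) (1 / 2) := by
  have : Nonempty (Fin k) := ⟨⟨0, hk⟩⟩
  simpa using! map_sq_norm_stdGaussian (E := EuclideanSpace ℝ (Fin k))

instance isProbabilityMeasure_chiSquared (k : ℕ) : IsProbabilityMeasure (chiSquared k) :=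
  Measure.isProbabilityMeasure_map (by fun_prop)

theorem measurable_betaPDF (a b : ℝ) : Measurable (betaPDF a b) :=
  (measurable_betaPDFReal a b).ennreal_ofReal

theorem measurable_gammaPDF (a c : ℝ) : Measurable (gammaPDF a c) :=
  (measurable_gammaPDFReal a c).ennreal_ofReal

/-- Splitting a total `s` in proportions `v` and `1 - v` gives `u = v s` and `t = (1 - v) s`, with
Jacobian factor `s⁻¹ = (u + t)⁻¹`. The powers of `s` cancel and the exponential factors. -/
theorem gammaPDF_add_mul_betaPDF {a b c u t : ℝ} (ha : 0 < a) (hb : 0 < b) (hc : 0 < c)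
    (hu : 0 < u) (ht : 0 < t) :
    gammaPDF (a + b) c (u + t) * (ENNReal.ofReal (u + t)⁻¹ * betaPDF a b ((u + t)⁻¹ * u)) =
      gammaPDF a c u * gammaPDF b c t := by
  have hs : 0 < u + t := by positivity
  have hlt : (u + t)⁻¹ * u < 1 := by
    rw [inv_mul_lt_iff₀ hs]; linarith
  have hA := Real.Gamma_pos_of_pos ha
  have hB := Real.Gamma_pos_of_pos hb
  have hAB := Real.Gamma_pos_of_pos (add_pos ha hb)
  have hbeta := beta_pos ha hb
  rw [gammaPDF_of_nonneg hs.le, gammaPDF_of_nonneg hu.le, gammaPDF_of_nonneg ht.le,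
    betaPDF_of_pos_lt_one (by positivity) hlt, ← ENNReal.ofReal_mul (by positivity),
    ← ENNReal.ofReal_mul (by positivity), ← ENNReal.ofReal_mul (by positivity)]
  congr 1
  have h1 : 1 - (u + t)⁻¹ * u = (u + t)⁻¹ * t := by field_simp; ring
  have h2 : (u + t) ^ (a + b - 1) = (u + t) ^ (a - 1) * (u + t) ^ (b - 1) * (u + t) := by
    rw [← Real.rpow_add hs, ← Real.rpow_add_one hs.ne']
    congr 1
    ring
  have h3 : Real.exp (-(c * (u + t))) = Real.exp (-(c * u)) * Real.exp (-(c * t)) := by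
    rw [← Real.exp_add]
    congr 1
    ring
  have h4 := Real.rpow_pos_of_pos hs (a - 1)
  have h5 := Real.rpow_pos_of_pos hs (b - 1)
  rw [h1, Real.mul_rpow (by positivity) hu.le, Real.mul_rpow (by positivity) ht.le,
    Real.inv_rpow hs.le, Real.inv_rpow hs.le, h2, h3, Real.rpow_add hc, beta]
  field_simp

/-- After the shift `s = u + t`, the `Gamma(b)` factor integrates to 1. At `u = 0` the left side
vanishes, while the right side does not when `a = 1`. -/
theorem lintegral_gammaPDF_mul_betaPDF {a b c u : ℝ} (ha : 0 < a) (hb : 0 < b) (hc : 0 < c)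
    (hu : u ≠ 0) :
    ∫⁻ s, gammaPDF (a + b) c s * (ENNReal.ofReal s⁻¹ * betaPDF a b (s⁻¹ * u)) =
      gammaPDF a c u := by
  rw [← lintegral_add_left_eq_self _ u]
  calc ∫⁻ t, gammaPDF (a + b) c (u + t) *
        (ENNReal.ofReal (u + t)⁻¹ * betaPDF a b ((u + t)⁻¹ * u))
      = ∫⁻ t, gammaPDF a c u * gammaPDF b c t := by
        refine lintegral_congr_ae ?_
        filter_upwards [Measure.ae_ne volume 0] with t ht
        rcases lt_or_gt_of_ne hu with hu | hu
        · rw [gammaPDF_of_neg hu, zero_mul]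
          rcases lt_or_ge (u + t) 0 with hs | hs
          · rw [gammaPDF_of_neg hs, zero_mul]
          · rw [betaPDF_eq_zero_of_nonpos
              (mul_nonpos_of_nonneg_of_nonpos (inv_nonneg.2 hs) hu.le), mul_zero, mul_zero]
        rcases lt_or_gt_of_ne ht with ht | ht
        · rw [gammaPDF_of_neg ht, mul_zero]
          rcases le_or_gt (u + t) 0 with hs | hs
          · rw [ENNReal.ofReal_of_nonpos (inv_nonpos.2 hs), zero_mul, mul_zero]
          · rw [betaPDF_eq_zero_of_one_le, mul_zero, mul_zero]
            rw [le_inv_mul_iff₀ hs]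
            linarith
        · exact gammaPDF_add_mul_betaPDF ha hb hc hu ht
    _ = gammaPDF a c u := by
        rw [lintegral_const_mul _ (measurable_gammaPDF b c), lintegral_gammaPDF_eq_one hb hc,
          mul_one]

/-- The product of independent `Beta(a, b)` and `Gamma(a + b)` variables is a `Gamma(a)`
variable. -/
theorem map_mul_betaMeasure_prod_gammaMeasure {a b c : ℝ} (ha : 0 < a) (hb : 0 < b) (hc : 0 < c) :
    ((betaMeasure a b).prod (gammaMeasure (a + b) c)).map (fun p => p.1 * p.2) =
      gammaMeasure a c := by
  have := isProbabilityMeasureBeta ha hb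
  have := isProbabilityMeasure_gammaMeasure (add_pos ha hb) hc
  have hβ := measurable_betaPDF a b
  have hγ := measurable_gammaPDF (a + b) c
  refine Measure.ext_of_lintegral _ fun f hf => ?_
  rw [lintegral_map hf (by fun_prop), lintegral_prod_symm' _ (by fun_prop), gammaMeasure,
    lintegral_withDensity_eq_lintegral_mul _ hγ
      (Measurable.lintegral_prod_left (by fun_prop)), gammaMeasure,
    lintegral_withDensity_eq_lintegral_mul _ (measurable_gammaPDF a c) hf]
  have hscale : ∀ s : ℝ, s ≠ 0 → (gammaPDF (a + b) c * fun s => ∫⁻ v, f (v * s) ∂betaMeasure a b) s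
      = ∫⁻ u, gammaPDF (a + b) c s *
        (ENNReal.ofReal s⁻¹ * betaPDF a b (s⁻¹ * u)) * f u := by
    intro s hs
    rw [Pi.mul_apply]
    rcases lt_or_gt_of_ne hs with hs | hs
    · simp [gammaPDF_of_neg hs]
    · simp_rw [mul_assoc]
      rw [lintegral_const_mul _ (by fun_prop), lintegral_const_mul _ (by fun_prop), betaMeasure,
        lintegral_withDensity_eq_lintegral_mul _ hβ (by fun_prop)]
      congr 1
      -- Substitution `v = s⁻¹ u`, so that `f` no longer depends on `s` and Tonelli applies.
      conv_lhs => rw [← Real.smul_map_volume_mul_left (inv_ne_zero hs.ne')]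
      rw [lintegral_smul_measure, lintegral_map (by fun_prop) (by fun_prop),
        abs_of_pos (inv_pos.2 hs), smul_eq_mul]
      congr 1
      refine lintegral_congr fun u => ?_
      rw [Pi.mul_apply, mul_right_comm, inv_mul_cancel₀ hs.ne', one_mul]
  rw [lintegral_congr_ae ((Measure.ae_ne volume 0).mono hscale), lintegral_lintegral_swap
    (by fun_prop)]
  refine lintegral_congr_ae ?_
  filter_upwards [Measure.ae_ne volume 0] with u hu
  rw [lintegral_mul_const _ (by fun_prop), lintegral_gammaPDF_mul_betaPDF ha hb hc hu, Pi.mul_apply]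

/-! ### Gaussian vectors under projections and linear maps -/

section OrthogonalDecomposition

variable {E : Type*} [NormedAddCommGroup E] [InnerProductSpace ℝ E] [FiniteDimensional ℝ E]
  [MeasurableSpace E] [BorelSpace E]

theorem charFun_map_coe_stdGaussian (K : Submodule ℝ E) (t : E) :
    charFun ((stdGaussian K).map ((↑) : K → E)) t =
      charFun (stdGaussian K) (K.orthogonalProjectionOnto t) := by
  rw [charFun_apply, charFun_apply, integral_map (by fun_prop)
    (Continuous.aestronglyMeasurable (by fun_prop))]
  simp

/-- Independent standard Gaussian vectors in a subspace and its orthogonal complement add up to a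
standard Gaussian vector. -/
theorem map_add_stdGaussian_prod_stdGaussian_orthogonal (K : Submodule ℝ E) :
    ((stdGaussian K).prod (stdGaussian Kᗮ)).map (fun p => (p.1 : E) + (p.2 : E)) =
      stdGaussian E := by
  have h : ((stdGaussian K).prod (stdGaussian Kᗮ)).map (fun p => (p.1 : E) + (p.2 : E)) =
      (((stdGaussian K).map ((↑) : K → E)).prod ((stdGaussian Kᗮ).map ((↑) : Kᗮ → E))).map
        (fun p => p.1 + p.2) := by
    rw [Measure.map_prod_map _ _ (by fun_prop) (by fun_prop),
      Measure.map_map (by fun_prop) (by fun_prop)]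
    rfl
  have := Measure.isProbabilityMeasure_map (μ := stdGaussian K) (f := ((↑) : K → E)) (by fun_prop)
  have := Measure.isProbabilityMeasure_map (μ := stdGaussian Kᗮ) (f := ((↑) : Kᗮ → E)) (by fun_prop)
  refine Measure.ext_of_charFun (funext fun t => ?_)
  rw [h, charFun_map_add_prod_eq_mul, Pi.mul_apply, charFun_map_coe_stdGaussian, charFun_map_coe_stdGaussian,
    charFun_stdGaussian, charFun_stdGaussian, charFun_stdGaussian, ← Complex.exp_add]
  -- Pythagoras makes the two Gaussian exponents add up.
  have h2 := Submodule.norm_sq_eq_add_norm_sq_projection t K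
  congr 1
  rw [← Complex.ofReal_pow ‖t‖, h2]
  push_cast
  ring

theorem map_sq_norm_stdGaussian_eq_chiSquared {k : ℕ} (hk : Module.finrank ℝ E = k) :
    (stdGaussian E).map (fun x => ‖x‖ ^ 2) = chiSquared k := by
  subst hk
  let e := (stdOrthonormalBasis ℝ E).repr
  rw [chiSquared, ← stdGaussian_map e, Measure.map_map (by fun_prop) (by fun_prop)]
  congr 1
  ext x
  simp

end OrthogonalDecomposition

/-- Linear images of standard Gaussian vectors. -/
theorem map_mulVec_stdGaussian {m k : ℕ} (M : Matrix (Fin m) (Fin k) ℝ) :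
    (stdGaussian (EuclideanSpace ℝ (Fin k))).map (fun x => WithLp.toLp 2 (M *ᵥ x.ofLp)) =
      multivariateGaussian 0 (M * Mᵀ) := by
  have hM : (M * Mᵀ).PosSemidef := by
    simpa using Matrix.posSemidef_self_mul_conjTranspose M
  have hcont : Continuous fun x : EuclideanSpace ℝ (Fin k) =>
      (WithLp.toLp 2 (M *ᵥ x.ofLp) : EuclideanSpace ℝ (Fin m)) := by fun_prop
  have := Measure.isProbabilityMeasure_map (μ := stdGaussian (EuclideanSpace ℝ (Fin k)))
    hcont.aemeasurable
  refine Measure.ext_of_charFun (funext fun t => ?_)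
  rw [charFun_multivariateGaussian hM, charFun_apply, integral_map hcont.aemeasurable
    (Continuous.aestronglyMeasurable (by fun_prop))]
  have h : ∀ x : EuclideanSpace ℝ (Fin k),
      inner ℝ (WithLp.toLp 2 (M *ᵥ x.ofLp) : EuclideanSpace ℝ (Fin m)) t =
        inner ℝ x (WithLp.toLp 2 (Mᵀ *ᵥ t.ofLp)) := by
    intro x
    simp only [EuclideanSpace.inner_eq_star_dotProduct, star_trivial]
    rw [dotProduct_mulVec, ← mulVec_transpose]
  simp_rw [h]
  rw [← charFun_apply, charFun_stdGaussian, ← Complex.ofReal_pow, ← real_inner_self_eq_norm_sq]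
  simp only [EuclideanSpace.inner_eq_star_dotProduct, star_trivial, inner_zero_right]
  congr 1
  rw [← mulVec_mulVec, dotProduct_mulVec t.ofLp, ← mulVec_transpose]
  push_cast
  ring

/-- A vector of i.i.d. `N(0, σ²)` variables is `σ` times a standard Gaussian vector. -/
theorem hasLaw_smul_stdGaussian_of_iIndepFun {Ω : Type*} [MeasurableSpace Ω] {P : Measure Ω}
    [IsProbabilityMeasure P] {n : ℕ} {σ : ℝ} {ε : Ω → EuclideanSpace ℝ (Fin n)}
    (hε_indep : iIndepFun (fun (i : Fin n) (s : Ω) => ε s i) P)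
    (hε_law : ∀ i : Fin n, HasLaw (fun s => ε s i) (gaussianReal 0 (σ ^ 2).toNNReal) P) :
    HasLaw ε ((stdGaussian (EuclideanSpace ℝ (Fin n))).map fun x => σ • x) P := by
  have hm : ∀ i, AEMeasurable (fun s => ε s i) P := fun i => (hε_law i).aemeasurable
  have hε : AEMeasurable ε P := by
    have : AEMeasurable (fun s => (WithLp.toLp 2 fun i => ε s i : EuclideanSpace ℝ (Fin n))) P :=
      (by fun_prop : Measurable (WithLp.toLp 2 : (Fin n → ℝ) → EuclideanSpace ℝ (Fin n))
        ).comp_aemeasurable (aemeasurable_pi_lambda _ hm)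
    exact this
  refine ⟨hε, ?_⟩
  have := Measure.isProbabilityMeasure_map hε
  have := Measure.isProbabilityMeasure_map
    (μ := stdGaussian (EuclideanSpace ℝ (Fin n))) (f := fun x => σ • x) (by fun_prop)
  refine Measure.ext_of_charFun (funext fun t => ?_)
  refine ((iIndepFun_iff_charFun_pi hm).1 hε_indep t).trans ?_
  rw [charFun_map_smul, charFun_stdGaussian]
  simp_rw [fun i => (hε_law i).map_eq, charFun_gaussianReal]
  rw [← Complex.exp_sum, ← Complex.ofReal_pow, EuclideanSpace.real_norm_sq_eq]
  congr 1
  push_cast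
  rw [← Finset.sum_neg_distrib, Finset.sum_div]
  refine Finset.sum_congr rfl fun i _ => ?_
  rw [Real.coe_toNNReal _ (sq_nonneg σ)]
  simp only [PiLp.smul_apply, smul_eq_mul]
  push_cast
  ring

/-- A positive semidefinite matrix of rank `r` factors through `ℝʳ`. -/
theorem Matrix.PosSemidef.exists_mul_transpose_eq {d r : ℕ} {A : Matrix (Fin d) (Fin d) ℝ}
    (hA : A.PosSemidef) (hr : r = A.rank) : ∃ M : Matrix (Fin d) (Fin r) ℝ, M * Mᵀ = A := by
  have hcard := hA.isHermitian.rank_eq_card_non_zero_eigs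
  set l := hA.isHermitian.eigenvalues with hl
  set U : Matrix (Fin d) (Fin d) ℝ := ↑hA.isHermitian.eigenvectorUnitary with hU
  obtain ⟨e⟩ : Nonempty (Fin r ≃ {i // l i ≠ 0}) :=
    ⟨Fintype.equivOfCardEq (by rw [Fintype.card_fin, hr, hcard])⟩
  -- The columns of `U √l` with zero eigenvalue are dropped, which leaves exactly `r` of them.
  refine ⟨Matrix.of fun i k => U i (e k) * √(l (e k)), ?_⟩
  have hspec : A = U * diagonal l * Uᵀ := by
    have := hA.isHermitian.spectral_theorem
    rw [Unitary.conjStarAlgAut_apply] at this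
    simpa [star_eq_conjTranspose] using this
  ext i j
  conv_rhs => rw [hspec]
  rw [mul_apply, mul_apply]
  simp only [of_apply, transpose_apply, mul_diagonal]
  rw [e.sum_comp (fun k : {i // l i ≠ 0} => U i k * √(l k) * (U j k * √(l k)))]
  have : ∀ k, U i k * √(l k) * (U j k * √(l k)) = U i k * l k * U j k := by
    intro k
    linear_combination U i k * U j k * Real.mul_self_sqrt (hA.eigenvalues_nonneg k)
  simp_rw [this]
  rw [← Finset.sum_subtype (Finset.univ.filter (l · ≠ 0)) (by simp)
    (fun k => U i k * l k * U j k), Finset.sum_filter_of_ne]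
  intro k _ hk h0
  simp [h0] at hk

/-! ### Least squares as orthogonal projection -/

section LeastSquares

variable {n d : ℕ} {X : Matrix (Fin n) (Fin d) ℝ}

/-- The column space of a matrix. -/
noncomputable def columnSpace (X : Matrix (Fin n) (Fin d) ℝ) :
    Submodule ℝ (EuclideanSpace ℝ (Fin n)) :=
  LinearMap.range (Matrix.toEuclideanLin X)

theorem mulVec_injective_of_rank_eq (hX : X.rank = d) : Function.Injective X.mulVec := by
  have h := X.mulVecLin.finrank_range_add_finrank_ker
  have h2 : Module.finrank ℝ (LinearMap.range X.mulVecLin) = d := hX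
  rw [h2, Module.finrank_fin_fun, Nat.add_eq_left, Submodule.finrank_eq_zero,
    LinearMap.ker_eq_bot] at h
  exact h

theorem finrank_columnSpace (hX : X.rank = d) : Module.finrank ℝ (columnSpace X) = d := by
  have hinj : Function.Injective (Matrix.toEuclideanLin X) := by
    intro a b hab
    have := mulVec_injective_of_rank_eq hX (congrArg WithLp.ofLp hab)
    exact WithLp.ofLp_injective 2 this
  rw [columnSpace, LinearMap.finrank_range_of_inj hinj, finrank_euclideanSpace_fin]

theorem finrank_columnSpace_orthogonal (hX : X.rank = d) :
    Module.finrank ℝ (columnSpace X)ᗮ = n - d := by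
  have h := (columnSpace X).finrank_add_finrank_orthogonal
  rw [finrank_columnSpace hX, finrank_euclideanSpace_fin] at h
  omega

/-- Testing `q` against the column-space vector `X Xᵀ q` yields `‖Xᵀ q‖² = 0`. -/
theorem transpose_mulVec_eq_zero_of_mem_orthogonal {q : EuclideanSpace ℝ (Fin n)}
    (hq : q ∈ (columnSpace X)ᗮ) : Xᵀ *ᵥ q.ofLp = 0 := by
  have h := (Submodule.mem_orthogonal _ _).1 hq _ (LinearMap.mem_range_self
    (Matrix.toEuclideanLin X) (WithLp.toLp 2 (Xᵀ *ᵥ q.ofLp)))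
  simp only [EuclideanSpace.inner_eq_star_dotProduct, star_trivial, toLpLin_apply] at h
  rw [dotProduct_mulVec, ← mulVec_transpose] at h
  exact dotProduct_self_eq_zero.1 h

theorem olsEstimator_add_of_mem_orthogonal (z : EuclideanSpace ℝ (Fin n))
    {q : EuclideanSpace ℝ (Fin n)} (hq : q ∈ (columnSpace X)ᗮ) :
    olsEstimator X (z + q) = olsEstimator X z := by
  simp only [olsEstimator, WithLp.ofLp_add, mulVec_add, ← mulVec_mulVec,
    transpose_mulVec_eq_zero_of_mem_orthogonal hq, mulVec_zero, add_zero]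

theorem mulVec_olsEstimator_of_mem_columnSpace (hX : X.rank = d) {z : EuclideanSpace ℝ (Fin n)}
    (hz : z ∈ columnSpace X) : WithLp.toLp 2 (X *ᵥ (olsEstimator X z).ofLp) = z := by
  obtain ⟨γ, rfl⟩ := hz
  have hdet : IsUnit (Xᵀ * X).det := by
    rw [← isUnit_iff_isUnit_det]
    have := (Matrix.PosDef.conjTranspose_mul_self X (mulVec_injective_of_rank_eq hX)).isUnit
    simpa using this
  rw [olsEstimator, toLpLin_apply]
  dsimp only
  rw [mulVec_mulVec _ _ X, Matrix.mul_assoc, nonsing_inv_mul _ hdet,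
    one_mulVec]

/-- Adding a vector orthogonal to the columns to a vector in the column space: the residual sum
of squares is the squared length of the former. -/
theorem mul_residualVariance_add (hX : X.rank = d) {z q : EuclideanSpace ℝ (Fin n)}
    (hz : z ∈ columnSpace X) (hq : q ∈ (columnSpace X)ᗮ) :
    ((n : ℝ) - d) * residualVariance X (z + q) = ‖q‖ ^ 2 := by
  rw [residualVariance, olsEstimator_add_of_mem_orthogonal z hq,
    mulVec_olsEstimator_of_mem_columnSpace hX hz, add_sub_cancel_left]
  -- If `n = d`, the complement of the column space is trivial, so `q = 0` and the division by zero
  -- is harmless.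
  rcases eq_or_ne ((n : ℝ) - d) 0 with h | h
  · have hnd : n = d := by exact_mod_cast sub_eq_zero.1 h
    have h0 := finrank_columnSpace_orthogonal hX
    rw [Nat.sub_eq_zero_of_le hnd.le] at h0
    rw [Submodule.finrank_eq_zero.1 h0, Submodule.mem_bot] at hq
    simp [hq]
  · field_simp

theorem measurable_olsEstimator (X : Matrix (Fin n) (Fin d) ℝ) : Measurable (olsEstimator X) := by
  unfold olsEstimator
  exact Continuous.measurable (by fun_prop)

theorem measurable_residualVariance (X : Matrix (Fin n) (Fin d) ℝ) :
    Measurable (residualVariance X) := by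
  unfold residualVariance olsEstimator
  exact Continuous.measurable (by fun_prop)

end LeastSquares

/-! ### Combining independent pieces -/

section Independence

variable {Ω α β γ : Type*} [MeasurableSpace Ω] [MeasurableSpace α] [MeasurableSpace β]
  [MeasurableSpace γ] {P : Measure Ω} [IsProbabilityMeasure P]

theorem ProbabilityTheory.IndepFun.prodMk_right_of_prodMk_left {A : Ω → α} {B : Ω → β} {C : Ω → γ}
    (hA : AEMeasurable A P) (hB : AEMeasurable B P) (hC : AEMeasurable C P)
    (hAB : IndepFun A B P) (hABC : IndepFun (fun s => (A s, B s)) C P) :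
    IndepFun A (fun s => (B s, C s)) P := by
  have := Measure.isProbabilityMeasure_map hA
  have := Measure.isProbabilityMeasure_map hB
  have := Measure.isProbabilityMeasure_map hC
  refine indepFun_of_map_prodMk_eq_prod hA (hB.prodMk hC) (μ := P.map A)
    (ν := (P.map B).prod (P.map C)) ?_
  rw [← Measure.prodAssoc_prod, ← hAB.map_prod_eq_prod_map_map hA hB,
    ← hABC.map_prod_eq_prod_map_map (hA.prodMk hB) hC,
    AEMeasurable.map_map_of_aemeasurable (by fun_prop) ((hA.prodMk hB).prodMk hC)]
  rfl

end Independence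

/-- A `Beta(r/2, (m - r)/2)` multiple of a chi-squared variable with `m` degrees of freedom is a
chi-squared variable with `r` degrees of freedom. -/
theorem map_mul_extendedBeta_prod_chiSquared {r m : ℕ} (h : r ≤ m) :
    ((extendedBeta ((r : ℝ) / 2) (((m : ℝ) - r) / 2)).prod (chiSquared m)).map
      (fun p => p.1 * p.2) = chiSquared r := by
  unfold extendedBeta
  split_ifs with h1 h2
  · have hrm : m = r := by
      have : (m : ℝ) = r := by linarith
      exact_mod_cast this
    rw [hrm, Measure.dirac_prod, Measure.map_map (by fun_prop) (by fun_prop)]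
    convert Measure.map_id
    ext x
    simp
  -- Here `r = 0 < m`, and both sides are the point mass at 0.
  · have hr : r = 0 := by
      have : (r : ℝ) = 0 := by linarith
      exact_mod_cast this
    subst hr
    rw [Measure.dirac_prod, Measure.map_map (by fun_prop) (by fun_prop)]
    have h3 : (fun p : ℝ × ℝ => p.1 * p.2) ∘ Prod.mk 0 = fun _ => 0 := by ext; simp
    have h4 : (fun x : EuclideanSpace ℝ (Fin 0) => ‖x‖ ^ 2) = fun _ => 0 := by
      ext x; simp [Subsingleton.elim x 0]
    have h5 : chiSquared 0 = (stdGaussian (EuclideanSpace ℝ (Fin 0))).map fun _ => 0 := by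
      rw [← h4]; rfl
    rw [h3, h5, Measure.map_const, Measure.map_const, measure_univ, measure_univ]
  · have hr : 0 < r := by
      rcases Nat.eq_zero_or_pos r with h | h
      · simp [h] at h2
      · exact h
    have hrm : r < m := lt_of_le_of_ne h fun h => h1 (by simp [h])
    have hrm' : (r : ℝ) < m := by exact_mod_cast hrm
    rw [chiSquared_eq_gammaMeasure hr, chiSquared_eq_gammaMeasure (hr.trans hrm),
      show (m : ℝ) / 2 = r / 2 + (m - r) / 2 by ring]
    exact map_mul_betaMeasure_prod_gammaMeasure (by positivity) (by linarith) (by norm_num)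

/-- Giving a standard Gaussian direction an independent length whose square has a scaled
chi-squared distribution yields a scaled standard Gaussian vector. -/
theorem hasLaw_sqrt_smul_direction {Ω : Type*} [MeasurableSpace Ω] {P : Measure Ω}
    [IsProbabilityMeasure P] {r : ℕ} {σ : ℝ} (hσ : 0 < σ) {T : Ω → ℝ}
    {w : Ω → EuclideanSpace ℝ (Fin r)}
    (hT : HasLaw T ((chiSquared r).map fun t => σ ^ 2 * t) P)
    (hw : HasLaw w (stdGaussian (EuclideanSpace ℝ (Fin r))) P) (hTw : IndepFun w T P) :
    HasLaw (fun s => √(T s / ‖w s‖ ^ 2) • w s)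
      ((stdGaussian (EuclideanSpace ℝ (Fin r))).map fun x => σ • x) P := by
  let u : EuclideanSpace ℝ (Fin r) → EuclideanSpace ℝ (Fin r) := fun x => ‖x‖⁻¹ • x
  have hu : Measurable u := by fun_prop
  let g : EuclideanSpace ℝ (Fin r) × ℝ → EuclideanSpace ℝ (Fin r) := fun p => √p.2 • p.1
  have hg : Measurable g := by fun_prop
  have hTm := hT.aemeasurable
  have hwm := hw.aemeasurable
  have huw : AEMeasurable (fun s => u (w s)) P := hu.comp_aemeasurable hwm
  have hind : IndepFun (fun s => u (w s)) T P := hTw.comp hu measurable_id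
  have hmodel : IndepFun u (fun x => σ ^ 2 * ‖x‖ ^ 2)
      (stdGaussian (EuclideanSpace ℝ (Fin r))) :=
    indepFun_direction_sq_norm_stdGaussian.comp measurable_id (measurable_const_mul (σ ^ 2))
  have hT' : P.map T = (stdGaussian (EuclideanSpace ℝ (Fin r))).map
      fun x => σ ^ 2 * ‖x‖ ^ 2 := by
    rw [hT.map_eq, chiSquared, Measure.map_map (by fun_prop) (by fun_prop)]
    rfl
  have hu' : P.map (fun s => u (w s)) = (stdGaussian (EuclideanSpace ℝ (Fin r))).map u := by
    rw [← hw.map_eq, AEMeasurable.map_map_of_aemeasurable hu.aemeasurable hwm]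
    rfl
  -- A single Gaussian `x` provides a pair with the same joint law, and `g` sends that pair back to
  -- `σ x`.
  have hjoint : P.map (fun s => (u (w s), T s)) =
      (stdGaussian (EuclideanSpace ℝ (Fin r))).map (fun x => (u x, σ ^ 2 * ‖x‖ ^ 2)) := by
    rw [hind.map_prod_eq_prod_map_map huw hTm, hT', hu',
      hmodel.map_prod_eq_prod_map_map (by fun_prop) (by fun_prop)]
  have hfun : (fun s => √(T s / ‖w s‖ ^ 2) • w s) = fun s => g (u (w s), T s) := by
    funext s
    simp only [g, u]
    rw [Real.sqrt_div' _ (by positivity), Real.sqrt_sq (norm_nonneg _), smul_smul, div_eq_mul_inv]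
  rw [hfun]
  refine ⟨hg.comp_aemeasurable (huw.prodMk hTm), ?_⟩
  have h1 := congrArg (Measure.map g) hjoint
  rw [AEMeasurable.map_map_of_aemeasurable hg.aemeasurable (huw.prodMk hTm),
    Measure.map_map hg (by fun_prop)] at h1
  refine h1.trans (congrArg (fun f => Measure.map f _) (funext fun x => ?_))
  simp only [Function.comp_apply, g, u]
  rw [← mul_pow, Real.sqrt_sq (by positivity), smul_smul]
  rcases eq_or_ne x 0 with rfl | hx
  · simp
  · rw [mul_assoc, mul_inv_cancel₀ (norm_ne_zero_iff.2 hx), mul_one]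

/-! ### The Gaussian linear model -/

section LinearModel

variable {Ω : Type*} [MeasurableSpace Ω] {P : Measure Ω} {n d : ℕ}
  {X : Matrix (Fin n) (Fin d) ℝ} {β : EuclideanSpace ℝ (Fin d)} {σ : ℝ}
  {y : Ω → EuclideanSpace ℝ (Fin n)}

/-- The laws of `β̂` and of the residual sum of squares in the Gaussian linear model. -/
theorem exists_map_olsEstimator_residualVariance (hX : X.rank = d)
    (hy : HasLaw y ((stdGaussian (EuclideanSpace ℝ (Fin n))).map
      fun x => WithLp.toLp 2 (X *ᵥ β.ofLp) + σ • x) P) :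
    ∃ μ : Measure (EuclideanSpace ℝ (Fin d)), IsProbabilityMeasure μ ∧
      P.map (fun s => (olsEstimator X (y s), ((n : ℝ) - d) * residualVariance X (y s))) =
        μ.prod ((chiSquared (n - d)).map fun t => σ ^ 2 * t) := by
  have hols := measurable_olsEstimator X
  have hres := measurable_residualVariance X
  let K := columnSpace X
  let z : EuclideanSpace ℝ (Fin n) := WithLp.toLp 2 (X *ᵥ β.ofLp)
  have hz : z ∈ K := ⟨β, rfl⟩
  let f : K → EuclideanSpace ℝ (Fin d) := fun x => olsEstimator X (z + σ • (x : _))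
  have hf : Measurable f := by fun_prop
  refine ⟨(stdGaussian K).map f, Measure.isProbabilityMeasure_map hf.aemeasurable, ?_⟩
  have hchi : (chiSquared (n - d)).map (fun t => σ ^ 2 * t) =
      (stdGaussian Kᗮ).map fun q => σ ^ 2 * ‖q‖ ^ 2 := by
    rw [← map_sq_norm_stdGaussian_eq_chiSquared (finrank_columnSpace_orthogonal hX),
      Measure.map_map (by fun_prop) (by fun_prop)]
    rfl
  let F : EuclideanSpace ℝ (Fin n) → EuclideanSpace ℝ (Fin d) × ℝ :=
    fun x => (olsEstimator X x, ((n : ℝ) - d) * residualVariance X x)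
  have hF : Measurable F := by fun_prop
  have h1 : P.map (fun s => F (y s)) = (P.map y).map F :=
    (AEMeasurable.map_map_of_aemeasurable hF.aemeasurable hy.aemeasurable).symm
  refine h1.trans ?_
  -- With the noise split along `K` and `Kᗮ`, the pair becomes a product map: `β̂` uses only `p.1`,
  -- the residual sum of squares only `p.2`.
  rw [hchi, Measure.map_prod_map _ _ hf (by fun_prop), hy.map_eq,
    ← map_add_stdGaussian_prod_stdGaussian_orthogonal K, Measure.map_map hF (by fun_prop),
    Measure.map_map (by fun_prop) (by fun_prop)]
  refine congrArg (fun f => Measure.map f _) (funext fun p => ?_)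
  have hp : σ • (p.2 : EuclideanSpace ℝ (Fin n)) ∈ Kᗮ := Kᗮ.smul_mem σ p.2.2
  have hp' : z + σ • (p.1 : EuclideanSpace ℝ (Fin n)) ∈ K := K.add_mem hz (K.smul_mem σ p.1.2)
  have hsum : z + σ • ((p.1 : EuclideanSpace ℝ (Fin n)) + (p.2 : EuclideanSpace ℝ (Fin n))) =
      (z + σ • (p.1 : EuclideanSpace ℝ (Fin n))) + σ • (p.2 : EuclideanSpace ℝ (Fin n)) := by
    rw [smul_add, add_assoc]
  change F (z + σ • ((p.1 : EuclideanSpace ℝ (Fin n)) + (p.2 : EuclideanSpace ℝ (Fin n)))) =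
    (f p.1, σ ^ 2 * ‖p.2‖ ^ 2)
  rw [hsum]
  simp only [F]
  rw [olsEstimator_add_of_mem_orthogonal _ hp, mul_residualVariance_add hX hp' hp, norm_smul,
    mul_pow, Real.norm_eq_abs, sq_abs]
  rfl

theorem hasLaw_mul_residualVariance (hX : X.rank = d)
    (hy : HasLaw y ((stdGaussian (EuclideanSpace ℝ (Fin n))).map
      fun x => WithLp.toLp 2 (X *ᵥ β.ofLp) + σ • x) P) :
    HasLaw (fun s => ((n : ℝ) - d) * residualVariance X (y s))
      ((chiSquared (n - d)).map fun t => σ ^ 2 * t) P := by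
  obtain ⟨μ, hμ, h⟩ := exists_map_olsEstimator_residualVariance hX hy
  have hA : AEMeasurable (fun s => olsEstimator X (y s)) P :=
    (measurable_olsEstimator X).comp_aemeasurable hy.aemeasurable
  have hB : AEMeasurable (fun s => ((n : ℝ) - d) * residualVariance X (y s)) P := ((measurable_residualVariance X).const_mul ((n : ℝ) - d)).comp_aemeasurable
    hy.aemeasurable
  refine ⟨hB, ?_⟩
  have h2 := congrArg (Measure.map Prod.snd) h
  rw [Measure.map_snd_prod, measure_univ, one_smul,
    AEMeasurable.map_map_of_aemeasurable (by fun_prop) (hA.prodMk hB)] at h2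
  exact h2

/-- The least squares estimator and the residual variance are independent. -/
theorem indepFun_olsEstimator_residualVariance [IsProbabilityMeasure P] (hX : X.rank = d)
    (hy : HasLaw y ((stdGaussian (EuclideanSpace ℝ (Fin n))).map
      fun x => WithLp.toLp 2 (X *ᵥ β.ofLp) + σ • x) P) :
    IndepFun (fun s => olsEstimator X (y s))
      (fun s => ((n : ℝ) - d) * residualVariance X (y s)) P := by
  obtain ⟨μ, hμ, h⟩ := exists_map_olsEstimator_residualVariance hX hy
  exact indepFun_of_map_prodMk_eq_prod
    ((measurable_olsEstimator X).comp_aemeasurable hy.aemeasurable)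
    (((measurable_residualVariance X).const_mul ((n : ℝ) - d)).comp_aemeasurable
      hy.aemeasurable) h

end LinearModel

/-! ### Carving the noise -/

theorem proposition6
    {Ω : Type*} [MeasurableSpace Ω] (P : Measure Ω) [IsProbabilityMeasure P]
    {n d r : ℕ} (X : Matrix (Fin n) (Fin d) ℝ) (hX : X.rank = d)
    (β : EuclideanSpace ℝ (Fin d)) (σ : ℝ) (hσ : 0 < σ)
    -- the Gaussian linear model `y = X β + ε` with i.i.d. `N(0, σ²)` errors
    (ε : Ω → EuclideanSpace ℝ (Fin n))
    (hε_indep : iIndepFun (fun (i : Fin n) (s : Ω) => ε s i) P)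
    (hε_law : ∀ i : Fin n, HasLaw (fun s => ε s i) (gaussianReal 0 (σ ^ 2).toNNReal) P)
    (y : Ω → EuclideanSpace ℝ (Fin n))
    (hy : ∀ s, y s = WithLp.toLp 2 (X *ᵥ β.ofLp) + ε s)
    (Δ : Matrix (Fin d) (Fin d) ℝ) (hΔ : (Δ - designCov X).PosSemidef)
    (hr : r = (Δ - designCov X).rank) (hn : d + r ≤ n)
    -- auxiliary variables, generated independently of the data and of each other
    (v : Ω → ℝ) (hv : HasLaw v (extendedBeta ((r : ℝ) / 2) (((n : ℝ) - d - r) / 2)) P)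
    (w : Ω → EuclideanSpace ℝ (Fin r))
    (hw : HasLaw w (multivariateGaussian 0 (1 : Matrix (Fin r) (Fin r) ℝ)) P)
    (hvw : IndepFun v w P)
    (hdata : IndepFun y (fun s => (v s, w s)) P) :
    HasLaw (fun s => ((n : ℝ) - d) * v s * residualVariance X (y s))
        ((chiSquared r).map (fun t => σ ^ 2 * t)) P ∧
      (∃ M : Matrix (Fin d) (Fin r) ℝ, M * Mᵀ = Δ - designCov X) ∧
      ∀ M : Matrix (Fin d) (Fin r) ℝ, M * Mᵀ = Δ - designCov X →
        HasLaw (fun s => carvedNoise X M (y s) (v s) (w s))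
            (multivariateGaussian 0 (σ ^ 2 • (Δ - designCov X))) P ∧
          IndepFun (fun s => olsEstimator X (y s))
            (fun s => carvedNoise X M (y s) (v s) (w s)) P := by
  have hols := measurable_olsEstimator X
  have hres := measurable_residualVariance X
  have hε := hasLaw_smul_stdGaussian_of_iIndepFun hε_indep hε_law
  have hyl : HasLaw y ((stdGaussian (EuclideanSpace ℝ (Fin n))).map
      fun x => WithLp.toLp 2 (X *ᵥ β.ofLp) + σ • x) P := by
    have hadd : HasLaw (fun x : EuclideanSpace ℝ (Fin n) => WithLp.toLp 2 (X *ᵥ β.ofLp) + x)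
        ((stdGaussian (EuclideanSpace ℝ (Fin n))).map
          fun x => WithLp.toLp 2 (X *ᵥ β.ofLp) + σ • x)
        ((stdGaussian (EuclideanSpace ℝ (Fin n))).map fun x => σ • x) :=
      ⟨by fun_prop, by rw [Measure.map_map (by fun_prop) (by fun_prop)]; rfl⟩
    rw [show y = fun s => WithLp.toLp 2 (X *ᵥ β.ofLp) + ε s from funext hy]
    exact hadd.fun_comp hε
  rw [multivariateGaussian_zero_one] at hw
  have hym := hyl.aemeasurable
  have hvm := hv.aemeasurable
  have hwm := hw.aemeasurable
  set S : Ω → ℝ := fun s => ((n : ℝ) - d) * residualVariance X (y s) with hS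
  have hSl : HasLaw S _ P := hasLaw_mul_residualVariance hX hyl
  have hSm := hSl.aemeasurable
  have hA : AEMeasurable (fun s => olsEstimator X (y s)) P := hols.comp_aemeasurable hym
  have hAS : IndepFun (fun s => olsEstimator X (y s)) S P :=
    indepFun_olsEstimator_residualVariance hX hyl
  have hSvw : IndepFun S (fun s => (v s, w s)) P :=
    hdata.comp (hres.const_mul ((n : ℝ) - d)) measurable_id
  have hASvw : IndepFun (fun s => (olsEstimator X (y s), S s)) (fun s => (v s, w s)) P :=
    hdata.comp (hols.prodMk (hres.const_mul ((n : ℝ) - d))) measurable_id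
  -- Pairwise independence would not suffice: the noise mixes `S`, `v` and `w`.
  have hA_Svw : IndepFun (fun s => olsEstimator X (y s)) (fun s => (S s, (v s, w s))) P :=
    IndepFun.prodMk_right_of_prodMk_left hA hSm (hvm.prodMk hwm) hAS hASvw
  have hw_vS : IndepFun w (fun s => (v s, S s)) P :=
    IndepFun.prodMk_right_of_prodMk_left hwm hvm hSm hvw.symm
      (hSvw.symm.comp measurable_swap measurable_id)
  have hvS : IndepFun v S P := (hSvw.comp measurable_id measurable_fst).symm
  have hT : (fun s => ((n : ℝ) - d) * v s * residualVariance X (y s)) = fun s => v s * S s := by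
    funext s
    simp only [hS]
    ring
  have hTl : HasLaw (fun s => v s * S s) ((chiSquared r).map (fun t => σ ^ 2 * t)) P := by
    have hm : ((n - d : ℕ) : ℝ) = n - d := Nat.cast_sub (by omega)
    refine ⟨hvm.mul hSm, ?_⟩
    have : IsProbabilityMeasure (extendedBeta ((r : ℝ) / 2) (((n : ℝ) - d - r) / 2)) := by
      rw [← hv.map_eq]
      exact Measure.isProbabilityMeasure_map hvm
    have h1 : P.map (fun s => v s * S s) = (P.map fun s => (v s, S s)).map fun p => p.1 * p.2 :=
      (AEMeasurable.map_map_of_aemeasurable (measurable_fst.mul measurable_snd).aemeasurable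
        (hvm.prodMk hSm)).symm
    have h2 := map_mul_extendedBeta_prod_chiSquared (r := r) (m := n - d) (by omega)
    rw [hm] at h2
    rw [h1, hvS.map_prod_eq_prod_map_map hvm hSm, hv.map_eq, hSl.map_eq, ← h2,
      ← Measure.map_id (μ := extendedBeta ((r : ℝ) / 2) (((n : ℝ) - d - r) / 2)),
      Measure.map_prod_map _ _ measurable_id (by fun_prop), Measure.map_id,
      Measure.map_map (by fun_prop) (by fun_prop), Measure.map_map (by fun_prop) (by fun_prop)]
    refine congrArg (fun f => Measure.map f _) (funext fun p => ?_)
    simp only [Function.comp_apply, Prod.map, id]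
    ring
  refine ⟨hT ▸ hTl, hΔ.exists_mul_transpose_eq hr, fun M hM => ?_⟩
  have hcarve : (fun s => carvedNoise X M (y s) (v s) (w s)) = fun s =>
      WithLp.toLp 2 (M *ᵥ (√(v s * S s / ‖w s‖ ^ 2) • w s).ofLp) := by
    funext s
    have := congrFun hT s
    rw [carvedNoise, this, WithLp.ofLp_smul, mulVec_smul, WithLp.toLp_smul]
  rw [hcarve]
  constructor
  · have h1 := hasLaw_sqrt_smul_direction hσ hTl hw
      (hw_vS.comp measurable_id (measurable_fst.mul measurable_snd))
    have hMl : HasLaw (fun x : EuclideanSpace ℝ (Fin r) =>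
        (WithLp.toLp 2 (M *ᵥ x.ofLp) : EuclideanSpace ℝ (Fin d)))
        (multivariateGaussian 0 (σ ^ 2 • (Δ - designCov X)))
        ((stdGaussian (EuclideanSpace ℝ (Fin r))).map fun x => σ • x) := by
      have hc : Continuous fun x : EuclideanSpace ℝ (Fin r) =>
        (WithLp.toLp 2 (M *ᵥ x.ofLp) : EuclideanSpace ℝ (Fin d)) := by fun_prop
      refine ⟨hc.aemeasurable, ?_⟩
      -- Using `σ M` absorbs the scale: its Gram matrix is `σ² M Mᵀ`.
      have h2 := map_mulVec_stdGaussian (σ • M)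
      rw [transpose_smul, Matrix.smul_mul, Matrix.mul_smul, smul_smul, ← sq, hM] at h2
      rw [← h2, Measure.map_map hc.measurable (by fun_prop)]
      refine congrArg (fun f => Measure.map f _) (funext fun x => ?_)
      simp [mulVec_smul, smul_mulVec]
    exact hMl.fun_comp h1
  · have hG : Measurable fun p : ℝ × (ℝ × EuclideanSpace ℝ (Fin r)) =>
        (WithLp.toLp 2 (M *ᵥ (√(p.2.1 * p.1 / ‖p.2.2‖ ^ 2) • p.2.2).ofLp) :
          EuclideanSpace ℝ (Fin d)) := by
      have hc : Continuous fun x : EuclideanSpace ℝ (Fin r) =>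
        (WithLp.toLp 2 (M *ᵥ x.ofLp) : EuclideanSpace ℝ (Fin d)) := by fun_prop
      exact hc.measurable.comp (by fun_prop)
    exact hA_Svw.comp measurable_id hG
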